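/- Let $\kappa$ be a regular uncountable cardinal and let $S\subseteq\kappa$ be a non-reflecting stationary set, i.e. $S$ is stationary in $\kappa$ and, for every $\delta<\kappa$ of uncountable cofinality, $S\cap\delta$ is not stationary in $\delta$. Let $\mathcal S$ be an infinite partition of $S$ (into nonempty, pairwise disjoint sets), and suppose that $\clubsuit_{\mathrm{AD}}(\mathcal S,1,2)$ holds, that is, there is a sequence $\langle\mathcal A_\alpha\mid\alpha\in S\rangle$ of families of sets of ordinals such that: 1. for every limit ordinal $\alpha\in S$, $\mathcal A_\alpha$ is a nonempty family of pairwise disjoint cofinal subsets of $\alpha$; 2. for all distinct $A,A'\in\bigcup_{\alpha\in S}\mathcal A_\alpha$, $\sup(A\cap A')<\sup(A)$; 3. $|\mathcal A_\alpha|=1$ for every $\alpha\in S$; 4. for every family $\mathcal B$ of at most two subsets of $\kappa$, each of cardinality $\kappa$, and for every $T\in\mathcal S$, the set $\{\alpha\in T\mid \sup(A\cap B)=\alpha\text{ for all }A\in\mathcal A_\alpha\text{ and }B\in\mathcal B\}$ is stationary in $\kappa$. (In particular, every member of $\mathcal S$ is stationary.) Then there exists a ladder-system Dowker space of cardinality $\kappa$.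 Explicitly, there is a sequence $\langle L_\alpha\mid\alpha<\kappa\rangle$, where each $L_\alpha$ is either empty or $\alpha$ is a limit ordinal and $L_\alpha$ is a cofinal subset of $\alpha$, such that the set $\kappa$ with the topology in which $U\subseteq\kappa$ is open iff for every $\alpha\in U$ either $L_\alpha=\emptyset$ or $\{\gamma\in L_\alpha\mid\gamma\ge\beta\}\subseteq U$ for some $\beta\in L_\alpha$, is a Dowker space: it is Hausdorff and normal, but its product with the unit interval $[0,1]$ is not normal. -/

import Mathlib

universe u

namespace LadderDowker

open Set Order Cardinal

/-- `S ∩ o` is a stationary subset of the ordinal `o`. -/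
def StationaryIn (o : Ordinal.{u}) (S : Set Ordinal.{u}) : Prop :=
  IsStationary {x : Iio o | (x : Ordinal.{u}) ∈ S}

/-- `S` is a non-reflecting stationary subset of `κ`: it is stationary in `κ`, and `S ∩ δ` is not
stationary in `δ` for any `δ < κ` of uncountable cofinality. -/
structure IsNonReflectingStationary (κ : Cardinal.{u}) (S : Set Ordinal.{u}) : Prop where
  subset : S ⊆ Iio κ.ord
  stationary : StationaryIn κ.ord S
  nonreflecting : ∀ δ < κ.ord, ℵ₀ < δ.cof → ¬ StationaryIn δ S

/-- `𝒮` is a partition of `S` into nonempty pairwise disjoint sets. -/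
structure IsPartitionOf (𝒮 : Set (Set Ordinal.{u})) (S : Set Ordinal.{u}) : Prop where
  nonempty : ∀ T ∈ 𝒮, T.Nonempty
  disjoint : 𝒮.PairwiseDisjoint id
  sUnion_eq : ⋃₀ 𝒮 = S

/-- `A` is a cofinal subset of the ordinal `α`. -/
def IsCofinalSubset (A : Set Ordinal.{u}) (α : Ordinal.{u}) : Prop :=
  A ⊆ Iio α ∧ ∀ β < α, ∃ γ ∈ A, β ≤ γ

/-- `⟨𝒜 α ∣ α ∈ S⟩` is an AD-multi-ladder system. The first field says that the members of the
`𝒜 α` are sets of ordinals (bounded), not proper classes, so that all suprema below are genuine;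
it has content only at the `α ∈ S` that are not limit ordinals. -/
structure IsADMultiLadderSystem (S : Set Ordinal.{u})
    (𝒜 : Ordinal.{u} → Set (Set Ordinal.{u})) : Prop where
  bddAbove : ∀ α ∈ S, ∀ A ∈ 𝒜 α, BddAbove A
  nonempty : ∀ α ∈ S, IsSuccLimit α → (𝒜 α).Nonempty
  disjoint : ∀ α ∈ S, IsSuccLimit α → (𝒜 α).PairwiseDisjoint id
  cofinal : ∀ α ∈ S, IsSuccLimit α → ∀ A ∈ 𝒜 α, IsCofinalSubset A α
  almost_disjoint : ∀ A ∈ ⋃ α ∈ S, 𝒜 α, ∀ A' ∈ ⋃ α ∈ S, 𝒜 α, A ≠ A' → sSup (A ∩ A') < sSup A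

/-- The principle `♣_AD(𝒮, μ, <θ)` for subsets of `κ`. (Taking `ℬ = ∅` in the last clause, every
member of `𝒮` is stationary as soon as `θ ≠ 0`.) -/
def ClubADLT (κ : Cardinal.{u}) (𝒮 : Set (Set Ordinal.{u})) (μ θ : Cardinal.{u}) : Prop :=
  ∃ 𝒜 : Ordinal.{u} → Set (Set Ordinal.{u}),
    IsADMultiLadderSystem (⋃₀ 𝒮) 𝒜 ∧
    (∀ α ∈ ⋃₀ 𝒮, #(𝒜 α) = Cardinal.lift.{u + 1} μ) ∧
    ∀ ℬ : Set (Set Ordinal.{u}),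
      (∀ B ∈ ℬ, B ⊆ Iio κ.ord ∧ #B = Cardinal.lift.{u + 1} κ) →
      #ℬ < Cardinal.lift.{u + 1} θ →
      ∀ S ∈ 𝒮, StationaryIn κ.ord {α ∈ S | ∀ A ∈ 𝒜 α, ∀ B ∈ ℬ, sSup (A ∩ B) = α}

/-- The principle `♣_AD(𝒮, μ, θ)`, where families of at most `θ` many sets are guessed. -/
def ClubAD (κ : Cardinal.{u}) (𝒮 : Set (Set Ordinal.{u})) (μ θ : Cardinal.{u}) : Prop :=
  ClubADLT κ 𝒮 μ (succ θ)

/-- `A ⊆* B`: either `A = ∅`, or a final segment of `A` starting at some `a ∈ A` lies in `B`. -/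
def AlmostSubset {X : Type*} [LinearOrder X] (A B : Set X) : Prop :=
  A = ∅ ∨ ∃ a ∈ A, ∀ b ∈ A, a ≤ b → b ∈ B

/-- `⟨L α ∣ α < κ⟩` is a ladder system: each `L α` is empty or `α` is a limit ordinal and `L α` is a
cofinal subset of `α`. -/
def IsLadderSystem (κ : Cardinal.{u}) (L : Ordinal.{u} → Set Ordinal.{u}) : Prop :=
  ∀ α < κ.ord, L α = ∅ ∨ (IsSuccLimit α ∧ IsCofinalSubset (L α) α)

/-- The underlying set `κ` of the ladder-system space determined by `L`. -/
def LadderSpace (κ : Cardinal.{u}) (_L : Ordinal.{u} → Set Ordinal.{u}) : Type (u + 1) :=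
  Iio κ.ord

/-- `U ⊆ κ` is open iff `L α ⊆* U` for every `α ∈ U`. -/
instance ladderTopology (κ : Cardinal.{u}) (L : Ordinal.{u} → Set Ordinal.{u}) :
    TopologicalSpace (LadderSpace κ L) where
  IsOpen (U : Set (Iio κ.ord)) :=
    ∀ α ∈ U, AlmostSubset {β : Iio κ.ord | (β : Ordinal.{u}) ∈ L (α : Ordinal.{u})} U
  isOpen_univ := by
    intro α _
    rcases eq_empty_or_nonempty {β : Iio κ.ord | (β : Ordinal.{u}) ∈ L (α : Ordinal.{u})}
      with h | ⟨a, ha⟩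
    · exact Or.inl h
    · exact Or.inr ⟨a, ha, fun _ _ _ => trivial⟩
  isOpen_inter := by
    intro U V hU hV α hα
    rcases hU α hα.1 with h | ⟨a, ha, hau⟩
    · exact Or.inl h
    rcases hV α hα.2 with h | ⟨b, hb, hbv⟩
    · exact Or.inl h
    refine Or.inr ⟨max a b, ?_, fun c hc hle =>
      ⟨hau c hc ((le_max_left _ _).trans hle), hbv c hc ((le_max_right _ _).trans hle)⟩⟩
    rcases max_choice a b with h | h <;> rw [h] <;> assumption
  isOpen_sUnion := by
    rintro s hs α ⟨U, hU, hα⟩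
    rcases hs U hU α hα with h | ⟨a, ha, hau⟩
    · exact Or.inl h
    · exact Or.inr ⟨a, ha, fun b hb hle => ⟨U, hU, hau b hb hle⟩⟩

/-- A Dowker space: a normal Hausdorff space whose product with the unit interval is not normal. -/
def IsDowkerSpace (X : Type*) [TopologicalSpace X] : Prop :=
  T2Space X ∧ NormalSpace X ∧ ¬ NormalSpace (X × unitInterval)

end LadderDowker

namespace LadderDowker

open Set Order Cardinal

/-! An infinite partition of `S` yields a rank `r` from the ordinals to `ℕ`, each of whose fibres
contains a cell. At a limit `α ∈ S`, keep only the part of the guessing ladder of rank below `r α`,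
if it is still cofinal; otherwise the ladder is empty. Ladders thus descend in rank, and any two
cofinal sets of rank below `n` are met cofinally by the ladder of some `α` of rank exactly `n`.

Two cofinal closed sets always intersect: as `κ` has uncountable cofinality, each has a cofinal part
of bounded rank, and a point whose ladder meets both parts cofinally lies in both sets. So of two
disjoint closed sets one is bounded, and normality reduces to separating a bounded closed set from a
closed set. This is where non-reflection enters: with almost disjointness it makes the ladders up to
any `δ < κ` have pairwise disjoint tails (`exists_disjoint_tails`).

The product with `[0,1]` is not normal because the closed sets of points of rank at least `n`
decrease to `∅` but have no open expansion with empty intersection: the complement of some member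
would be a cofinal closed set of rank below `n`, and guessing puts a point of rank `n` into it. -/

/-! ### Disjoint tails from non-reflection -/

/-- If `D ∩ δ` is interrupted by suitable cofinal sets at every limit `δ < μ`, then the members of
an almost disjoint ladder system on `D` have pairwise disjoint tails below any `δ < μ`. -/
theorem exists_disjoint_tails {μ : Ordinal.{u}} {D : Set Ordinal.{u}}
    {a : Ordinal.{u} → Set Ordinal.{u}}
    (hlim : ∀ α ∈ D, IsSuccLimit α) (hcof : ∀ α ∈ D, a α ⊆ Iio α)
    (had : ∀ α ∈ D, ∀ β ∈ D, α ≠ β → sSup (a α ∩ a β) < α)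
    (hC : ∀ δ < μ, IsSuccLimit δ → ∃ C, IsCofinalSubset C δ ∧
      ∀ α ∈ D, α < δ → ∃ c, IsGreatest (C ∩ Iio α) c)
    (δ : Ordinal.{u}) (hδ : δ < μ) :
    ∃ f : Ordinal.{u} → Ordinal.{u}, (∀ α ∈ D, α < δ → f α < α) ∧
      ∀ α ∈ D, ∀ β ∈ D, α < δ → β < δ → ∀ x, x ∈ a α → x ∈ a β → f α ≤ x → f β ≤ x → α = β := by
  induction δ using Ordinal.limitRecOn with
  | zero => exact ⟨id, fun α _ h => (not_lt_bot h).elim, fun α _ _ _ h => (not_lt_bot h).elim⟩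
  | add_one δ ih =>
    simp only [← Order.succ_eq_add_one] at hδ ⊢
    obtain ⟨f, hf, hd⟩ := ih ((lt_succ δ).trans hδ)
    have key : ∀ α ∈ D, δ ∈ D → α < δ → ∀ x, x ∈ a α → x ∈ a δ →
        succ (sSup (a α ∩ a δ)) ≤ x → False := by
      intro α hα hδD hlt x hx hx' hle
      have : x ≤ sSup (a α ∩ a δ) :=
        le_csSup ⟨α, fun y hy => (hcof α hα hy.1).le⟩ ⟨hx, hx'⟩
      exact (lt_succ _).not_ge (hle.trans this)
    classical
    -- Each earlier tail is moved past its bounded overlap with `a δ`, so the tail at `δ` itself may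
    -- start at 0.
    refine ⟨fun α => if α < δ then
      (if δ ∈ D then max (f α) (succ (sSup (a α ∩ a δ))) else f α) else 0, ?_, ?_⟩
    · intro α hα hlt
      rcases (lt_succ_iff.1 hlt).lt_or_eq with h | h
      · by_cases hD : δ ∈ D
        · simp only [h, hD, if_true]
          exact max_lt (hf α hα h) ((hlim α hα).succ_lt (had α hα δ hD h.ne))
        · simpa only [h, hD, if_true, if_false] using hf α hα h
      · simp only [h, lt_irrefl, if_false]
        exact h ▸ (hlim α hα).bot_lt
    · intro α hα β hβ hαδ hβδ x hxα hxβ h1 h2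
      rcases (lt_succ_iff.1 hαδ).lt_or_eq with h | h <;>
      rcases (lt_succ_iff.1 hβδ).lt_or_eq with h' | h'
      · refine hd α hα β hβ h h' x hxα hxβ ?_ ?_
        · simp only [h, if_true] at h1
          split_ifs at h1
          exacts [(le_max_left _ _).trans h1, h1]
        · simp only [h', if_true] at h2
          split_ifs at h2
          exacts [(le_max_left _ _).trans h2, h2]
      · subst h'
        simp only [h, hβ, if_true] at h1
        exact (key α hα hβ h x hxα hxβ ((le_max_right _ _).trans h1)).elim
      · subst h
        simp only [h', hα, if_true] at h2
        exact (key β hβ hα h' x hxβ hxα ((le_max_right _ _).trans h2)).elim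
      · exact h.trans h'.symm
  | limit δ hδl ih =>
    obtain ⟨C, ⟨hCδ, hCu⟩, hC⟩ := hC δ hδ hδl
    choose! F hF hFd using fun γ (hγ : γ < δ) => ih γ hγ (hγ.trans hδ)
    choose! c hc using hC
    -- `C` cuts `δ` into blocks: `α ∈ D` lies above `c α` and at or below the next point of `C`. The
    -- successor makes `N (c α)` a strict bound for the whole block, so the inductive hypothesis
    -- there handles the block.
    let N : Ordinal.{u} → Ordinal.{u} := fun γ => succ (sInf (C ∩ Ioi γ))
    have hN : ∀ γ < δ, N γ < δ := by
      intro γ hγ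
      obtain ⟨d, hd, hd'⟩ := hCu _ (hδl.succ_lt hγ)
      exact hδl.succ_lt (hCδ (csInf_mem (s := C ∩ Ioi γ) ⟨d, hd, succ_le_iff.1 hd'⟩).1)
    have hcδ : ∀ α ∈ D, α < δ → c α < δ := fun α hα h => hCδ (hc α hα h).1.1
    have hlt : ∀ α ∈ D, α < δ → α < N (c α) := by
      intro α hα h
      refine lt_succ_iff.2 (le_csInf ?_ ?_)
      · obtain ⟨d, hd, hd'⟩ := hCu _ (hδl.succ_lt (hcδ α hα h))
        exact ⟨d, hd, succ_le_iff.1 hd'⟩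
      · intro d hd
        by_contra hlt
        exact hd.2.not_ge ((hc α hα h).2 ⟨hd.1, not_le.1 hlt⟩)
    -- Starting each tail at or above `c α` separates different blocks: a common point of two tails
    -- forces `c α = c β`.
    have aux : ∀ α ∈ D, ∀ β ∈ D, α < δ → β < δ → ∀ x ∈ a α, c β ≤ x → c β ≤ c α := by
      intro α hα β hβ h h' x hx hle
      exact (hc α hα h).2 ⟨(hc β hβ h').1.1, hle.trans_lt (hcof α hα hx)⟩
    refine ⟨fun α => max (F (N (c α)) α) (c α), ?_, ?_⟩
    · intro α hα h
      exact max_lt (hF _ (hN _ (hcδ α hα h)) α hα (hlt α hα h)) (hc α hα h).1.2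
    · intro α hα β hβ h h' x hx hx' h1 h2
      have e : c α = c β := le_antisymm
        (aux β hβ α hα h' h x hx' ((le_max_right _ _).trans h1))
        (aux α hα β hβ h h' x hx ((le_max_right _ _).trans h2))
      refine hFd _ (hN _ (hcδ α hα h)) α hα β hβ (hlt α hα h) (e ▸ hlt β hβ h') x hx hx'
        ((le_max_left _ _).trans h1) ?_
      rw [e]
      exact (le_max_left _ _).trans h2

/-- A limit ordinal of countable cofinality has a cofinal subset that meets every proper initial
segment in a finite set. -/
theorem exists_cofinal_of_cof_le_aleph0 {δ : Ordinal.{u}} (hδ : IsSuccLimit δ)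
    (hcof : δ.cof ≤ ℵ₀) :
    ∃ C, IsCofinalSubset C δ ∧ ∀ α, 0 < α → α < δ → ∃ c, IsGreatest (C ∩ Iio α) c := by
  obtain ⟨s, hs, hs'⟩ := Order.exists_cof_eq (α := Iio δ)
  have hcount : s.Countable := by
    rw [← Cardinal.le_aleph0_iff_set_countable, hs', Ordinal.cof_Iio, ← Ordinal.lift_cof,
      Cardinal.lift_le_aleph0]
    exact hcof
  have : Nonempty (Iio δ) := ⟨⟨0, hδ.bot_lt⟩⟩
  obtain ⟨e, rfl⟩ := hcount.exists_eq_range hs.nonempty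
  have hm := partialSups_monotone e
  -- Partial suprema make the sequence monotone, so only finitely many values lie below a given `α <
  -- δ`; adding 0 keeps the initial segments nonempty.
  refine ⟨insert 0 (range fun n => (partialSups e n : Ordinal.{u})), ⟨?_, ?_⟩, ?_⟩
  · rintro x (rfl | ⟨n, rfl⟩)
    exacts [hδ.bot_lt, (partialSups e n).2]
  · intro β hβ
    obtain ⟨_, ⟨n, rfl⟩, hn⟩ := hs ⟨β, hβ⟩
    exact ⟨_, Or.inr ⟨n, rfl⟩, hn.trans (le_partialSups e n)⟩
  · intro α hα hαδ
    obtain ⟨_, ⟨n, rfl⟩, hn⟩ := hs ⟨α, hαδ⟩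
    have hfin : ((insert 0 (range fun n => (partialSups e n : Ordinal.{u}))) ∩ Iio α).Finite := by
      refine ((((finite_Iio n).image fun n => (partialSups e n : Ordinal.{u})).insert 0)).subset ?_
      rintro x ⟨rfl | ⟨k, rfl⟩, hk⟩
      · exact Or.inl rfl
      · refine Or.inr ⟨k, ?_, rfl⟩
        by_contra hkn
        have h1 : (⟨α, hαδ⟩ : Iio δ) ≤ partialSups e k :=
          (hn.trans (le_partialSups e n)).trans (hm (not_lt.1 hkn))
        exact (show (partialSups e k : Ordinal.{u}) < α from hk).not_ge h1
    have hne : ((insert 0 (range fun n => (partialSups e n : Ordinal.{u}))) ∩ Iio α).Nonempty :=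
      ⟨0, Or.inl rfl, hα⟩
    obtain ⟨c, hc⟩ := hfin.exists_maximal hne
    exact ⟨c, hc.1, fun y hy => not_lt.1 fun h => h.not_ge (hc.2 hy h.le)⟩

/-- Below an ordinal at which `S` does not reflect, there is a cofinal set whose initial
segments of length in `S` have a greatest element. -/
theorem exists_cofinal_of_not_stationaryIn {δ : Ordinal.{u}} (hδ : IsSuccLimit δ)
    {S : Set Ordinal.{u}} (hS : ¬ StationaryIn δ S) :
    ∃ C, IsCofinalSubset C δ ∧ ∀ α ∈ S, 0 < α → α < δ → ∃ c, IsGreatest (C ∩ Iio α) c := by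
  obtain ⟨t, ht, hd⟩ := not_isStationary_iff.1 hS
  -- The club `t` misses `S`. The supremum of a nonempty part of `t` below `α ∈ S` belongs to `t`,
  -- hence is not `α`; the added 0 covers an empty part.
  refine ⟨insert 0 (Subtype.val '' t), ⟨?_, ?_⟩, ?_⟩
  · rintro x (rfl | ⟨n, _, rfl⟩)
    exacts [hδ.bot_lt, n.2]
  · intro β hβ
    obtain ⟨b, hb, hle⟩ := ht.isCofinal ⟨β, hβ⟩
    exact ⟨_, Or.inr ⟨b, hb, rfl⟩, hle⟩
  · intro α hα h0 hαδ
    set E := insert 0 (Subtype.val '' t) ∩ Iio α with hE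
    have hEb : BddAbove E := ⟨α, fun y hy => hy.2.le⟩
    have hE0 : (0 : Ordinal.{u}) ∈ E := ⟨Or.inl rfl, h0⟩
    refine ⟨sSup E, ?_, fun y hy => le_csSup hEb hy⟩
    have hle : sSup E ≤ α := csSup_le ⟨0, hE0⟩ fun y hy => hy.2.le
    by_cases hz : sSup E = 0
    · rw [hz]; exact hE0
    have hlub : IsLUB {x ∈ t | (x : Ordinal.{u}) < α} (⟨sSup E, hle.trans_lt hαδ⟩ : Iio δ) := by
      refine ⟨fun x hx => le_csSup hEb ⟨Or.inr ⟨x, hx.1, rfl⟩, hx.2⟩, fun b hb => ?_⟩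
      refine (csSup_le ⟨0, hE0⟩ ?_ : sSup E ≤ (b : Ordinal.{u}))
      rintro y ⟨rfl | ⟨y, hy, rfl⟩, hyα⟩
      exacts [bot_le, hb ⟨hy, hyα⟩]
    have hne : {x ∈ t | (x : Ordinal.{u}) < α}.Nonempty := by
      by_contra hne
      refine hz (le_antisymm (csSup_le ⟨0, hE0⟩ ?_) bot_le)
      rintro y ⟨rfl | ⟨y, hy, rfl⟩, hyα⟩
      exacts [le_rfl, (hne ⟨y, hy, hyα⟩).elim]
    have hmem := ht.isLUB_mem (fun x hx => hx.1) hne hlub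
    refine ⟨Or.inr ⟨_, hmem, rfl⟩, hle.lt_of_ne fun h => ?_⟩
    exact disjoint_left.1 hd (show sSup E ∈ S from h ▸ hα) hmem

theorem IsNonReflectingStationary.exists_cofinal {κ : Cardinal.{u}} {S : Set Ordinal.{u}}
    (hS : IsNonReflectingStationary κ S) {δ : Ordinal.{u}} (hδκ : δ < κ.ord) (hδ : IsSuccLimit δ) :
    ∃ C, IsCofinalSubset C δ ∧ ∀ α ∈ S, 0 < α → α < δ → ∃ c, IsGreatest (C ∩ Iio α) c := by
  rcases le_or_gt δ.cof ℵ₀ with h | h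
  · obtain ⟨C, hC, hC'⟩ := exists_cofinal_of_cof_le_aleph0 hδ h
    exact ⟨C, hC, fun α _ => hC' α⟩
  · exact exists_cofinal_of_not_stationaryIn hδ (hS.nonreflecting δ hδκ h)

/-! ### Cofinal subsets of a regular cardinal -/

theorem mk_eq_of_isCofinalSubset {κ : Cardinal.{u}} (hκ : κ.IsRegular) {B : Set Ordinal.{u}}
    (hB : IsCofinalSubset B κ.ord) : #B = Cardinal.lift.{u + 1} κ := by
  apply le_antisymm
  · refine (Cardinal.mk_le_mk_of_subset hB.1).trans ?_
    rw [Cardinal.mk_Iio_ordinal, Cardinal.card_ord]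
  · have hc : IsCofinal {x : Iio κ.ord | (x : Ordinal.{u}) ∈ B} := by
      intro x
      obtain ⟨γ, hγ, hle⟩ := hB.2 x x.2
      exact ⟨⟨γ, hB.1 hγ⟩, hγ, hle⟩
    have h1 := Order.cof_le hc
    rw [Ordinal.cof_Iio, ← Ordinal.lift_cof, hκ.cof_ord] at h1
    refine h1.trans (Cardinal.mk_le_of_injective (f := fun x => ⟨x.1.1, x.2⟩) ?_)
    intro x y h
    exact Subtype.ext (Subtype.ext (congrArg (fun z : B => (z : Ordinal.{u})) h))

/-- Countably many bounds below `κ` have a common bound, since `κ` is regular and uncountable. -/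
theorem exists_isCofinalSubset_of_iUnion {κ : Cardinal.{u}} (hκ : κ.IsRegular) (hκ' : ℵ₀ < κ)
    {B : Set Ordinal.{u}} (hB : IsCofinalSubset B κ.ord) {G : ℕ → Set Ordinal.{u}}
    (hG : ∀ n, G n ⊆ Iio κ.ord) (hBG : B ⊆ ⋃ n, G n) : ∃ n, IsCofinalSubset (G n) κ.ord := by
  by_contra! h
  have hb : ∀ n, ∃ b < κ.ord, ∀ γ ∈ G n, γ < b := by
    intro n
    by_contra! hn
    exact h n ⟨hG n, hn⟩
  choose b hb hb' using hb
  have hsup : iSup b < κ.ord :=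
    Ordinal.lift_iSup_lt_of_lt_cof (by simpa [hκ.cof_ord] using hκ') hb
  obtain ⟨γ, hγ, hle⟩ := hB.2 _ hsup
  obtain ⟨n, hn⟩ := mem_iUnion.1 (hBG hγ)
  exact ((hb' n γ hn).trans_le (Ordinal.le_iSup b n)).not_ge hle

theorem isClub_isSuccLimit {κ : Cardinal.{u}} (hκ : ℵ₀ < κ) :
    IsClub {x : Iio κ.ord | IsSuccLimit (x : Ordinal.{u})} := by
  refine ⟨?_, ?_⟩
  · intro t ht hne _ x hx
    obtain ⟨y, hy⟩ := hne
    refine Ordinal.isSuccLimit_iff.2 ⟨?_, ?_⟩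
    · exact ((ht hy).bot_lt.trans_le (hx.1 hy)).ne'
    · refine isSuccPrelimit_of_succ_lt fun z hz => ?_
      obtain ⟨w, hw, hzw⟩ : ∃ w ∈ t, z < (w : Ordinal.{u}) := by
        by_contra! hcon
        exact hz.not_ge (hx.2 (show (⟨z, hz.trans x.2⟩ : Iio κ.ord) ∈ upperBounds t from
          fun w hw => hcon w hw))
      exact ((ht hw).succ_lt hzw).trans_le (hx.1 hw)
  · intro x
    have hlt : (x : Ordinal.{u}) + Ordinal.omega0 < κ.ord :=
      Ordinal.isPrincipal_add_ord hκ.le x.2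
        (by rw [← Cardinal.ord_aleph0]; exact Cardinal.ord_lt_ord.2 hκ)
    exact ⟨⟨_, hlt⟩, Ordinal.isSuccLimit_add _ Ordinal.isSuccLimit_omega0,
      show (x : Ordinal.{u}) ≤ x + Ordinal.omega0 from le_self_add⟩

/-! ### The topology of a ladder system -/

variable {κ : Cardinal.{u}} {L : Ordinal.{u} → Set Ordinal.{u}}

/-- The ordinal underlying a point of a ladder-system space. -/
def LadderSpace.val (x : LadderSpace κ L) : Ordinal.{u} :=
  Subtype.val (p := fun y => y ∈ Iio κ.ord) x

theorem LadderSpace.val_lt (x : LadderSpace κ L) : x.val < κ.ord :=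
  Subtype.prop (p := fun y => y ∈ Iio κ.ord) x

theorem LadderSpace.val_injective : Function.Injective (LadderSpace.val (κ := κ) (L := L)) :=
  fun _ _ h => Subtype.ext h

/-- Thresholds become arbitrary ordinals rather than elements of the ladder, so that several can be
combined by `max`. The bound `b < x.val` is required only for a nonempty ladder, since nothing lies
below 0. -/
theorem IsLadderSystem.isOpen_iff (hL : IsLadderSystem κ L) {U : Set (LadderSpace κ L)} :
    IsOpen U ↔ ∀ x ∈ U, ∃ b, ((L x.val).Nonempty → b < x.val) ∧
      ∀ y : LadderSpace κ L, y.val ∈ L x.val → b ≤ y.val → y ∈ U := by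
  refine forall₂_congr fun (x : LadderSpace κ L) hx => ⟨?_, ?_⟩
  · rintro (h | ⟨a, ha, hau⟩)
    · refine ⟨x.val, fun ⟨y, hy⟩ => ?_, fun y hy _ => ?_⟩
      · rcases hL x.val x.val_lt with h' | h'
        · simp [h'] at hy
        · exact (h.subset (show (⟨y, (h'.2.1 hy).trans x.val_lt⟩ : Iio κ.ord) ∈ _ from hy)).elim
      · exact (h.subset (show y ∈ _ from hy)).elim
    · refine ⟨a, fun _ => ?_, fun y hy hle => hau y hy hle⟩
      rcases hL x.val x.val_lt with h' | h'
      · exact ((h'.subset ha : (a : Ordinal.{u}) ∈ (∅ : Set Ordinal.{u}))).elim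
      · exact h'.2.1 ha
  · rintro ⟨b, hb, hbU⟩
    rcases hL x.val x.val_lt with h' | h'
    · exact Or.inl (eq_empty_of_forall_notMem fun y hy => (h'.subset hy).elim)
    · obtain ⟨z, hz, _⟩ := h'.2.2 0 h'.1.bot_lt
      obtain ⟨a, ha, hba⟩ := h'.2.2 b (hb ⟨z, hz⟩)
      refine Or.inr ⟨⟨a, (h'.2.1 ha).trans x.val_lt⟩, ha, fun y hy hle => hbU y hy ?_⟩
      exact hba.trans hle

theorem IsLadderSystem.lt_of_mem (hL : IsLadderSystem κ L) {x : LadderSpace κ L}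
    {y : Ordinal.{u}} (hy : y ∈ L x.val) : y < x.val := by
  rcases hL x.val x.val_lt with h | h
  · simp [h] at hy
  · exact h.2.1 hy

/-- A closed set contains every point whose ladder it meets cofinally. -/
theorem IsLadderSystem.mem_of_isClosed (hL : IsLadderSystem κ L) {K : Set (LadderSpace κ L)}
    (hK : IsClosed K) {x : LadderSpace κ L} (hx : 0 < x.val)
    (h : ∀ b < x.val, ∃ y ∈ K, y.val ∈ L x.val ∧ b ≤ y.val) : x ∈ K := by
  by_contra hxK
  obtain ⟨b, hb, hbK⟩ := hL.isOpen_iff.1 hK.isOpen_compl x hxK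
  obtain ⟨y, _, hy, _⟩ := h 0 hx
  obtain ⟨z, hz, hzx, hbz⟩ := h b (hb ⟨_, hy⟩)
  exact hbK z hzx hbz hz

theorem IsLadderSystem.t1Space (hL : IsLadderSystem κ L) : T1Space (LadderSpace κ L) := by
  refine ⟨fun x => isOpen_compl_iff.1 (hL.isOpen_iff.2 fun y _ => ?_)⟩
  by_cases hxy : x.val < y.val
  · refine ⟨succ x.val, fun ⟨z, hz⟩ => ?_, ?_⟩
    · rcases hL y.val y.val_lt with h | h
      · simp [h] at hz
      · exact h.1.succ_lt hxy
    · rintro z _ hle rfl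
      exact (lt_succ _).not_ge hle
  · refine ⟨0, fun ⟨z, hz⟩ => pos_of_gt (hL.lt_of_mem hz), ?_⟩
    rintro z hz _ rfl
    exact hxy (hL.lt_of_mem hz)

/-- Disjoint closed sets, one of which is bounded by `δ`, can be separated if the ladders up to `δ`
have pairwise disjoint tails. -/
theorem IsLadderSystem.separatedNhds (hL : IsLadderSystem κ L) {δ : Ordinal.{u}}
    {f : Ordinal.{u} → Ordinal.{u}} (hf : ∀ α ≤ δ, (L α).Nonempty → f α < α)
    (hfd : ∀ α ≤ δ, ∀ β ≤ δ, ∀ x, x ∈ L α → x ∈ L β → f α ≤ x → f β ≤ x → α = β)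
    {K₀ K₁ : Set (LadderSpace κ L)} (hK₀ : IsClosed K₀) (hK₁ : IsClosed K₁)
    (hd : Disjoint K₀ K₁) (hδ : ∀ x ∈ K₀, x.val ≤ δ) : SeparatedNhds K₀ K₁ := by
  have hb : ∀ K : Set (LadderSpace κ L), IsClosed K → ∀ x : LadderSpace κ L, ∃ b,
      ((L x.val).Nonempty → b < x.val) ∧
      (x ∉ K → ∀ y : LadderSpace κ L, y.val ∈ L x.val → b ≤ y.val → y ∉ K) := by
    intro K hK x
    by_cases hx : x ∈ K
    · exact ⟨0, fun ⟨z, hz⟩ => pos_of_gt (hL.lt_of_mem hz), fun h => (h hx).elim⟩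
    · obtain ⟨b, hb, hbK⟩ := hL.isOpen_iff.1 hK.isOpen_compl x hx
      exact ⟨b, hb, fun _ => hbK⟩
  choose b₀ hb₀ hb₀' using hb K₀ hK₀
  choose b₁ hb₁ hb₁' using hb K₁ hK₁
  -- One threshold serves all purposes: the tail avoids each closed set not containing `x`, is
  -- disjoint from the other tails up to `δ`, and stays above `δ` when `x` does.
  have hh : ∀ x : LadderSpace κ L, ∃ b, ((L x.val).Nonempty → b < x.val) ∧ b₀ x ≤ b ∧ b₁ x ≤ b ∧
      (x.val ≤ δ → f x.val ≤ b) ∧ (δ < x.val → δ < b) := by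
    intro x
    rcases le_or_gt x.val δ with h | h
    · exact ⟨max (f x.val) (max (b₀ x) (b₁ x)),
        fun hx => max_lt (hf _ h hx) (max_lt (hb₀ x hx) (hb₁ x hx)), by simp, by simp, by simp,
        fun h' => (h'.not_ge h).elim⟩
    · refine ⟨max (succ δ) (max (b₀ x) (b₁ x)),
        fun hx => max_lt ?_ (max_lt (hb₀ x hx) (hb₁ x hx)), by simp, by simp,
        fun h' => (h.not_ge h').elim, fun _ => lt_max_of_lt_left (lt_succ δ)⟩
      rcases hL x.val x.val_lt with h' | h'
      · exact (hx.ne_empty h').elim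
      · exact h'.1.succ_lt h
  choose h hlt h₀ h₁ hfh hδh using hh
  -- Closing a set under passage to the chosen ladder tails makes it open.
  let E : LadderSpace κ L → LadderSpace κ L → Prop := fun x y => y.val ∈ L x.val ∧ h x ≤ y.val
  let U : Set (LadderSpace κ L) → Set (LadderSpace κ L) :=
    fun K => {x | ∃ k ∈ K, Relation.ReflTransGen E k x}
  have hUo : ∀ K, IsOpen (U K) := fun K => hL.isOpen_iff.2 fun x ⟨k, hk, hkx⟩ =>
    ⟨h x, hlt x, fun y hy hle => ⟨k, hk, hkx.tail ⟨hy, hle⟩⟩⟩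
  have hU₀ : ∀ x ∈ U K₀, x ∉ K₁ ∧ x.val ≤ δ := by
    rintro x ⟨k, hk, hkx⟩
    induction hkx with
    | refl => exact ⟨disjoint_left.1 hd hk, hδ k hk⟩
    | tail _ hyz ih =>
      exact ⟨hb₁' _ ih.1 _ hyz.1 ((h₁ _).trans hyz.2), (hL.lt_of_mem hyz.1).le.trans ih.2⟩
  have hU₁ : ∀ x ∈ U K₁, x ∉ K₀ := by
    rintro x ⟨k, hk, hkx⟩
    induction hkx with
    | refl => exact disjoint_right.1 hd hk
    | tail _ hyz ih => exact hb₀' _ ih _ hyz.1 ((h₀ _).trans hyz.2)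
  refine ⟨U K₀, U K₁, hUo _, hUo _, fun x hx => ⟨x, hx, .refl⟩, fun x hx => ⟨x, hx, .refl⟩,
    disjoint_left.2 ?_⟩
  rintro x ⟨k, hk, hkx⟩
  induction hkx with
  | refl => exact fun hx => hU₁ _ hx hk
  | @tail y z hky hyz ih =>
    -- Suppose paths from `K₀` and `K₁` both end at `z`. The predecessor `w` on the second path is
    -- at most `δ`, as otherwise its tail lies above `δ`. Disjoint tails then give `w = y`, and the
    -- common endpoint moves one step back.
    rintro ⟨l, hl, hlz⟩
    rcases hlz.cases_tail with rfl | ⟨w, hlw, hwz⟩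
    · exact (hU₀ _ ⟨k, hk, hky.tail hyz⟩).1 hl
    · have hyδ := (hU₀ y ⟨k, hk, hky⟩).2
      have hwδ : w.val ≤ δ := by
        by_contra hw
        exact ((hδh w (not_le.1 hw)).trans_le hwz.2).not_ge ((hL.lt_of_mem hyz.1).le.trans hyδ)
      have hyw : y = w := LadderSpace.val_injective <| hfd _ hyδ _ hwδ z.val hyz.1 hwz.1
        ((hfh y hyδ).trans hyz.2) ((hfh w hwδ).trans hwz.2)
      exact ih ⟨l, hl, hyw ▸ hlw⟩

/-! ### Open expansions from normality of the product -/

/-- If `X × [0, 1]` is normal, then every decreasing sequence of closed sets with empty intersection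
has an open expansion with empty intersection. -/
theorem exists_open_expansion_of_normalSpace_prod {X : Type*} [TopologicalSpace X]
    [NormalSpace (X × unitInterval)] {F : ℕ → Set X} (hF : ∀ n, IsClosed (F n))
    (hanti : Antitone F) (hempty : ⋂ n, F n = ∅) :
    ∃ V : ℕ → Set X, (∀ n, IsOpen (V n)) ∧ (∀ n, F n ⊆ V n) ∧ ⋂ n, V n = ∅ := by
  let u : ℕ → ℝ := fun n => 1 / ((n : ℝ) + 1)
  have hu0 : ∀ n, 0 < u n := fun n => Nat.one_div_pos_of_nat
  have hu1 : ∀ n, u n ≤ 1 := fun n => by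
    simpa [u] using Nat.one_div_le_one_div (α := ℝ) (Nat.zero_le n)
  have hulim : Filter.Tendsto u Filter.atTop (nhds 0) := tendsto_one_div_add_atTop_nhds_zero_nat
  have hmem : ∀ x : X, ∃ m, x ∉ F m := by
    intro x
    by_contra! hx
    exact (hempty.subset (mem_iInter.2 hx)).elim
  let t : ℕ → unitInterval := fun n => ⟨u n, (hu0 n).le, hu1 n⟩
  -- Separate this staircase from `X × {0}`; the expansion consists of the slices at heights `t n`,
  -- which tend to 0.
  let C : Set (X × unitInterval) := ⋃ n, F n ×ˢ Ici (t n)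
  have hC : IsClosed C := by
    refine LocallyFinite.isClosed_iUnion (fun p => ?_) fun n => (hF n).prod isClosed_Ici
    obtain ⟨m, hm⟩ := hmem p.1
    refine ⟨(F m)ᶜ ×ˢ Set.univ, ((hF m).isOpen_compl.prod isOpen_univ).mem_nhds ⟨hm, trivial⟩,
      (finite_Iio m).subset ?_⟩
    rintro n ⟨q, hq, hq'⟩
    exact not_le.1 fun hmn => hq'.1 (hanti hmn hq.1)
  have hZ : IsClosed {p : X × unitInterval | p.2 = 0} :=
    isClosed_eq continuous_snd continuous_const
  have hCZ : Disjoint C {p : X × unitInterval | p.2 = 0} := by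
    refine disjoint_left.2 fun p hp hp0 => ?_
    obtain ⟨n, hn⟩ := mem_iUnion.1 hp
    have h1 : t n ≤ p.2 := hn.2
    rw [show p.2 = 0 from hp0] at h1
    exact (hu0 n).not_ge h1
  obtain ⟨A, B, hA, hB, hCA, hZB, hAB⟩ := normal_separation hC hZ hCZ
  refine ⟨fun n => {x | (x, t n) ∈ A}, fun n => hA.preimage (by fun_prop),
    fun n x hx => hCA (mem_iUnion.2 ⟨n, hx, self_mem_Ici⟩), eq_empty_of_forall_notMem fun x hx => ?_⟩
  have hlim : Filter.Tendsto (fun n => (x, t n)) Filter.atTop (nhds (x, (0 : unitInterval))) := by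
    refine tendsto_const_nhds.prodMk_nhds ?_
    rw [tendsto_subtype_rng]
    exact hulim
  obtain ⟨n, hn⟩ := (hlim.eventually (hB.mem_nhds (hZB rfl))).exists
  exact disjoint_left.1 hAB (mem_iInter.1 hx n) hn

/-! ### Rank guessing implies Dowker -/

/-- The ladders cofinally meet any two given cofinal subsets of `κ` of rank less than `n`, at some
point of rank `n`. -/
def GuessesAtRank (κ : Cardinal.{u}) (L : Ordinal.{u} → Set Ordinal.{u}) (r : Ordinal.{u} → ℕ) :
    Prop :=
  ∀ (n : ℕ) (B₀ B₁ : Set Ordinal.{u}), IsCofinalSubset B₀ κ.ord → IsCofinalSubset B₁ κ.ord →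
    (∀ β ∈ B₀, r β < n) → (∀ β ∈ B₁, r β < n) → ∃ α < κ.ord, 0 < α ∧ r α = n ∧
      (∀ b < α, ∃ y ∈ B₀, y ∈ L α ∧ b ≤ y) ∧ ∀ b < α, ∃ y ∈ B₁, y ∈ L α ∧ b ≤ y

/-- The ladders up to any `δ < κ` have pairwise disjoint tails. -/
def HasDisjointTails (κ : Cardinal.{u}) (L : Ordinal.{u} → Set Ordinal.{u}) : Prop :=
  ∀ δ < κ.ord, ∃ f : Ordinal.{u} → Ordinal.{u}, (∀ α ≤ δ, (L α).Nonempty → f α < α) ∧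
    ∀ α ≤ δ, ∀ β ≤ δ, ∀ x, x ∈ L α → x ∈ L β → f α ≤ x → f β ≤ x → α = β

theorem IsLadderSystem.exists_mem_inter (hL : IsLadderSystem κ L) {r : Ordinal.{u} → ℕ}
    (hguess : GuessesAtRank κ L r) {n : ℕ} {K₀ K₁ : Set (LadderSpace κ L)}
    (hK₀ : IsClosed K₀) (hK₁ : IsClosed K₁)
    (hc₀ : IsCofinalSubset {β ∈ LadderSpace.val '' K₀ | r β < n} κ.ord)
    (hc₁ : IsCofinalSubset {β ∈ LadderSpace.val '' K₁ | r β < n} κ.ord) :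
    ∃ x ∈ K₀ ∩ K₁, r x.val = n := by
  obtain ⟨α, hα, h0, hr, h₀, h₁⟩ :=
    hguess n _ _ hc₀ hc₁ (fun β hβ => hβ.2) (fun β hβ => hβ.2)
  let x : LadderSpace κ L := (⟨α, hα⟩ : Iio κ.ord)
  have key : ∀ K : Set (LadderSpace κ L), IsClosed K →
      (∀ b < α, ∃ y ∈ {β ∈ LadderSpace.val '' K | r β < n}, y ∈ L α ∧ b ≤ y) → x ∈ K := by
    intro K hK h
    refine hL.mem_of_isClosed hK (x := x) h0 fun b hb => ?_
    obtain ⟨_, ⟨⟨y, hy, rfl⟩, _⟩, hyL, hby⟩ := h b hb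
    exact ⟨y, hy, hyL, hby⟩
  exact ⟨x, ⟨key K₀ hK₀ h₀, key K₁ hK₁ h₁⟩, hr⟩

theorem image_val_subset (K : Set (LadderSpace κ L)) : LadderSpace.val '' K ⊆ Iio κ.ord := by
  rintro _ ⟨x, _, rfl⟩
  exact x.val_lt

/-- Guessing rules out two disjoint cofinal closed sets, and disjoint tails separate the remaining
pairs. -/
theorem IsLadderSystem.normalSpace (hκ : κ.IsRegular) (hκ' : ℵ₀ < κ) (hL : IsLadderSystem κ L)
    {r : Ordinal.{u} → ℕ} (hguess : GuessesAtRank κ L r) (htails : HasDisjointTails κ L) :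
    NormalSpace (LadderSpace κ L) := by
  have hbdd : ∀ K₀ K₁ : Set (LadderSpace κ L), IsClosed K₀ → IsClosed K₁ → Disjoint K₀ K₁ →
      ¬ IsCofinalSubset (LadderSpace.val '' K₀) κ.ord → SeparatedNhds K₀ K₁ := by
    intro K₀ K₁ hK₀ hK₁ hd hc
    obtain ⟨δ, hδ, hδK⟩ : ∃ δ < κ.ord, ∀ x ∈ K₀, x.val ≤ δ := by
      by_contra! h
      refine hc ⟨image_val_subset _, fun β hβ => ?_⟩
      obtain ⟨x, hx, hlt⟩ := h β hβ
      exact ⟨_, ⟨x, hx, rfl⟩, hlt.le⟩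
    obtain ⟨f, hf, hfd⟩ := htails δ hδ
    exact hL.separatedNhds hf hfd hK₀ hK₁ hd hδK
  have hrank : ∀ K : Set (LadderSpace κ L), IsCofinalSubset (LadderSpace.val '' K) κ.ord →
      ∃ n, ∀ m, n ≤ m → IsCofinalSubset {β ∈ LadderSpace.val '' K | r β < m} κ.ord := by
    intro K hK
    obtain ⟨n, hn⟩ := exists_isCofinalSubset_of_iUnion hκ hκ' hK
      (G := fun n => {β ∈ LadderSpace.val '' K | r β < n})
      (fun n β hβ => image_val_subset K hβ.1)
      (fun β hβ => mem_iUnion.2 ⟨r β + 1, hβ, Nat.lt_succ_self _⟩)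
    refine ⟨n, fun m hm => ⟨fun β hβ => image_val_subset K hβ.1, fun b hb => ?_⟩⟩
    obtain ⟨γ, hγ, hle⟩ := hn.2 b hb
    exact ⟨γ, ⟨hγ.1, hγ.2.trans_le hm⟩, hle⟩
  refine ⟨fun K₀ K₁ hK₀ hK₁ hd => ?_⟩
  by_cases hc₀ : IsCofinalSubset (LadderSpace.val '' K₀) κ.ord
  · by_cases hc₁ : IsCofinalSubset (LadderSpace.val '' K₁) κ.ord
    · obtain ⟨n₀, hn₀⟩ := hrank K₀ hc₀
      obtain ⟨n₁, hn₁⟩ := hrank K₁ hc₁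
      obtain ⟨x, hx, _⟩ := hL.exists_mem_inter hguess hK₀ hK₁ (hn₀ _ (le_max_left n₀ n₁))
        (hn₁ _ (le_max_right n₀ n₁))
      exact (disjoint_left.1 hd hx.1 hx.2).elim
    · exact (hbdd K₁ K₀ hK₁ hK₀ hd.symm hc₁).symm
  · exact hbdd K₀ K₁ hK₀ hK₁ hd hc₀

theorem IsLadderSystem.not_normalSpace_prod (hκ : κ.IsRegular) (hκ' : ℵ₀ < κ)
    (hL : IsLadderSystem κ L) {r : Ordinal.{u} → ℕ} (hr : ∀ α, ∀ β ∈ L α, r β < r α)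
    (hguess : GuessesAtRank κ L r) : ¬ NormalSpace (LadderSpace κ L × unitInterval) := by
  intro _
  let F : ℕ → Set (LadderSpace κ L) := fun n => {x | n ≤ r x.val}
  have hF : ∀ n, IsClosed (F n) := by
    refine fun n => isOpen_compl_iff.1 (hL.isOpen_iff.2 fun x hx => ⟨0, ?_, fun y hy _ => ?_⟩)
    · exact fun ⟨z, hz⟩ => pos_of_gt (hL.lt_of_mem hz)
    · exact not_le.2 ((hr _ _ hy).trans (not_le.1 hx))
  obtain ⟨V, hVo, hFV, hV⟩ := exists_open_expansion_of_normalSpace_prod hF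
    (fun m n hmn x hx => le_trans hmn hx)
    (eq_empty_of_forall_notMem fun x hx => (Nat.lt_succ_self _).not_ge (mem_iInter.1 hx (r x.val + 1)))
  have hrank : ∀ n, ∀ x ∈ (V n)ᶜ, r x.val < n := fun n x hx => not_le.1 fun h => hx (hFV n h)
  obtain ⟨n, hn⟩ := exists_isCofinalSubset_of_iUnion hκ hκ'
    (B := Iio κ.ord) ⟨subset_rfl, fun β hβ => ⟨β, hβ, le_rfl⟩⟩
    (G := fun n => {β ∈ LadderSpace.val '' (V n)ᶜ | r β < n})
    (fun n β hβ => image_val_subset _ hβ.1)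
    (by
      intro β hβ
      let x : LadderSpace κ L := (⟨β, hβ⟩ : Iio κ.ord)
      obtain ⟨n, hn⟩ : ∃ n, x ∉ V n := by
        by_contra! hx
        exact (hV.subset (mem_iInter.2 hx)).elim
      exact mem_iUnion.2 ⟨n, ⟨x, hn, rfl⟩, hrank n x hn⟩)
  -- Only one set has to be guessed here, so it is used twice.
  obtain ⟨x, hx, hxn⟩ :=
    hL.exists_mem_inter hguess (hVo n).isClosed_compl (hVo n).isClosed_compl hn hn
  exact (hrank n x hx.1).ne hxn

theorem IsLadderSystem.isDowkerSpace (hκ : κ.IsRegular) (hκ' : ℵ₀ < κ)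
    (hL : IsLadderSystem κ L) {r : Ordinal.{u} → ℕ} (hr : ∀ α, ∀ β ∈ L α, r β < r α)
    (hguess : GuessesAtRank κ L r) (htails : HasDisjointTails κ L) :
    IsDowkerSpace (LadderSpace κ L) := by
  have := hL.t1Space
  have hn := hL.normalSpace hκ hκ' hguess htails
  exact ⟨inferInstance, hn, hL.not_normalSpace_prod hκ hκ' hr hguess⟩

/-! ### The ranked ladder system from club guessing -/

/-- An infinite partition admits a rank function to `ℕ` each of whose fibres contains a cell. -/
theorem IsPartitionOf.exists_rank {𝒮 : Set (Set Ordinal.{u})} {S : Set Ordinal.{u}}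
    (h : IsPartitionOf 𝒮 S) (hinf : 𝒮.Infinite) :
    ∃ (r : Ordinal.{u} → ℕ), ∀ n, ∃ T ∈ 𝒮, ∀ α ∈ T, r α = n := by
  classical
  let e := hinf.natEmbedding
  have huniq : ∀ m n α, α ∈ (e m : Set Ordinal.{u}) → α ∈ (e n : Set Ordinal.{u}) → m = n := by
    intro m n α hm hn
    by_contra hne
    exact disjoint_left.1 (h.disjoint (e m).2 (e n).2
      fun h' => hne (e.injective (Subtype.ext h'))) hm hn
  -- Countably many cells are selected; every ordinal outside them gets rank 0.
  refine ⟨fun α => if hα : ∃ n, α ∈ (e n : Set Ordinal.{u}) then hα.choose else 0,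
    fun n => ⟨e n, (e n).2, fun α hα => ?_⟩⟩
  have hex : ∃ n, α ∈ (e n : Set Ordinal.{u}) := ⟨n, hα⟩
  simp only [hex, dif_pos]
  exact huniq _ _ α hex.choose_spec hα

/-- `♣_AD(𝒮, 1, 2)` in terms of a single almost disjoint ladder system. -/
theorem ClubAD.exists_ladder (hκ : κ.IsRegular) (hκ' : ℵ₀ < κ) {𝒮 : Set (Set Ordinal.{u})}
    (h : ClubAD κ 𝒮 1 2) :
    ∃ a : Ordinal.{u} → Set Ordinal.{u},
      (∀ α ∈ ⋃₀ 𝒮, IsSuccLimit α → IsCofinalSubset (a α) α) ∧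
      (∀ α ∈ ⋃₀ 𝒮, ∀ β ∈ ⋃₀ 𝒮, IsSuccLimit α → IsSuccLimit β → α ≠ β → sSup (a α ∩ a β) < α) ∧
      ∀ B₀ B₁, IsCofinalSubset B₀ κ.ord → IsCofinalSubset B₁ κ.ord → ∀ T ∈ 𝒮,
        ∃ α ∈ T, α < κ.ord ∧ IsSuccLimit α ∧
          (∀ b < α, ∃ y ∈ B₀, y ∈ a α ∧ b ≤ y) ∧ ∀ b < α, ∃ y ∈ B₁, y ∈ a α ∧ b ≤ y := by
  obtain ⟨𝒜, h𝒜, hone, hst⟩ := h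
  have hex : ∀ α ∈ ⋃₀ 𝒮, ∃ A, 𝒜 α = {A} := by
    intro α hα
    have := hone α hα
    rw [Cardinal.lift_one, Cardinal.mk_set_eq_one_iff] at this
    exact this
  choose! a ha using hex
  have hmem : ∀ α ∈ ⋃₀ 𝒮, a α ∈ 𝒜 α := fun α hα => by rw [ha α hα]; rfl
  have hcof : ∀ α ∈ ⋃₀ 𝒮, IsSuccLimit α → IsCofinalSubset (a α) α :=
    fun α hα hl => h𝒜.cofinal α hα hl _ (hmem α hα)
  have hsup : ∀ α ∈ ⋃₀ 𝒮, IsSuccLimit α → sSup (a α) = α := by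
    intro α hα hl
    obtain ⟨hsub, hc⟩ := hcof α hα hl
    obtain ⟨z, hz, _⟩ := hc 0 hl.bot_lt
    refine le_antisymm (csSup_le ⟨z, hz⟩ fun y hy => (hsub hy).le) (not_lt.1 fun hlt => ?_)
    obtain ⟨y, hy, hle⟩ := hc _ (hl.succ_lt hlt)
    exact (lt_succ _).not_ge (hle.trans (le_csSup ⟨α, fun y hy => (hsub hy).le⟩ hy))
  refine ⟨a, hcof, fun α hα β hβ hlα hlβ hne => ?_, fun B₀ B₁ hB₀ hB₁ T hT => ?_⟩
  · have := h𝒜.almost_disjoint (a α) (mem_iUnion₂.2 ⟨α, hα, hmem α hα⟩) (a β)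
      (mem_iUnion₂.2 ⟨β, hβ, hmem β hβ⟩)
      fun he => hne (by rw [← hsup α hα hlα, he, hsup β hβ hlβ])
    rwa [hsup α hα hlα] at this
  · have hB : ∀ B ∈ ({B₀, B₁} : Set (Set Ordinal.{u})),
        B ⊆ Iio κ.ord ∧ #B = Cardinal.lift.{u + 1} κ := by
      rintro B (rfl | rfl)
      exacts [⟨hB₀.1, mk_eq_of_isCofinalSubset hκ hB₀⟩, ⟨hB₁.1, mk_eq_of_isCofinalSubset hκ hB₁⟩]
    have hcard : #({B₀, B₁} : Set (Set Ordinal.{u})) < Cardinal.lift.{u + 1} (succ (2 : Cardinal.{u})) := by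
      rw [Cardinal.lift_succ, lt_succ_iff, Cardinal.lift_ofNat]
      exact Cardinal.mk_insert_le.trans (by rw [Cardinal.mk_singleton]; norm_num)
    -- Stationarity is used only to find a single guessing point in the club of limit ordinals.
    obtain ⟨x, ⟨hxT, hx⟩, hlim⟩ := hst _ hB hcard T hT (isClub_isSuccLimit hκ')
    have hxS : (x : Ordinal.{u}) ∈ ⋃₀ 𝒮 := ⟨T, hT, hxT⟩
    have hsub := (hcof x hxS hlim).1
    have key : ∀ B ∈ ({B₀, B₁} : Set (Set Ordinal.{u})), ∀ b < (x : Ordinal.{u}),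
        ∃ y ∈ B, y ∈ a x ∧ b ≤ y := by
      intro B hB b hb
      rw [← hx _ (hmem x hxS) B hB] at hb
      -- The supremum of `∅` is 0 by convention, and `b` lies strictly below the supremum.
      have hne : (a x ∩ B).Nonempty := by
        by_contra hne
        rw [not_nonempty_iff_eq_empty.1 hne, csSup_empty] at hb
        exact not_lt_bot hb
      obtain ⟨y, hy, hlt⟩ := exists_lt_of_lt_csSup hne hb
      exact ⟨y, hy.2, hy.1, hlt.le⟩
    exact ⟨x, hxT, x.2, hlim, key B₀ (Or.inl rfl), key B₁ (Or.inr rfl)⟩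

open Classical in
/-- The part of the ladder `a α` of rank less than that of `α`, provided that it is cofinal. -/
noncomputable def rankedLadder (S : Set Ordinal.{u}) (a : Ordinal.{u} → Set Ordinal.{u})
    (r : Ordinal.{u} → ℕ) (α : Ordinal.{u}) : Set Ordinal.{u} :=
  if α ∈ S ∧ IsSuccLimit α ∧ IsCofinalSubset {β ∈ a α | r β < r α} α then
    {β ∈ a α | r β < r α} else ∅

section rankedLadder

variable {S : Set Ordinal.{u}} {a : Ordinal.{u} → Set Ordinal.{u}} {r : Ordinal.{u} → ℕ}

theorem mem_rankedLadder {α β : Ordinal.{u}} : β ∈ rankedLadder S a r α ↔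
    (α ∈ S ∧ IsSuccLimit α ∧ IsCofinalSubset {β ∈ a α | r β < r α} α) ∧ β ∈ a α ∧ r β < r α := by
  unfold rankedLadder
  split_ifs with h
  · exact ⟨fun h' => ⟨h, h'⟩, fun h' => h'.2⟩
  · exact ⟨fun h' => h'.elim, fun h' => h h'.1⟩

theorem isLadderSystem_rankedLadder : IsLadderSystem κ (rankedLadder S a r) := by
  intro α _
  unfold rankedLadder
  split_ifs with h
  · exact Or.inr h.2
  · exact Or.inl rfl

theorem hasDisjointTails_rankedLadder (hκ : κ.IsRegular) (hS : IsNonReflectingStationary κ S)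
    (hcof : ∀ α ∈ S, IsSuccLimit α → IsCofinalSubset (a α) α)
    (had : ∀ α ∈ S, ∀ β ∈ S, IsSuccLimit α → IsSuccLimit β → α ≠ β → sSup (a α ∩ a β) < α) :
    HasDisjointTails κ (rankedLadder S a r) := by
  intro δ hδ
  have hκl : IsSuccLimit κ.ord := Cardinal.isSuccLimit_ord hκ.aleph0_le
  -- Tails are chosen below `succ δ` because `HasDisjointTails` includes `δ` itself.
  obtain ⟨f, hf, hfd⟩ := exists_disjoint_tails (D := {α ∈ S | IsSuccLimit α}) (a := a)
    (fun α hα => hα.2) (fun α hα => (hcof α hα.1 hα.2).1)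
    (fun α hα β hβ => had α hα.1 β hβ.1 hα.2 hβ.2)
    (fun δ hδ hl => by
      obtain ⟨C, hC, hC'⟩ := hS.exists_cofinal hδ hl
      exact ⟨C, hC, fun α hα => hC' α hα.1 hα.2.bot_lt⟩) (succ δ) (hκl.succ_lt hδ)
  refine ⟨f, fun α hα ⟨x, hx⟩ => ?_, fun α hα β hβ x hx hx' => ?_⟩
  · obtain ⟨⟨h1, h2, _⟩, _⟩ := mem_rankedLadder.1 hx
    exact hf α ⟨h1, h2⟩ (lt_succ_iff.2 hα)
  · obtain ⟨⟨h1, h2, _⟩, h3, _⟩ := mem_rankedLadder.1 hx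
    obtain ⟨⟨h1', h2', _⟩, h3', _⟩ := mem_rankedLadder.1 hx'
    exact hfd α ⟨h1, h2⟩ β ⟨h1', h2'⟩ (lt_succ_iff.2 hα) (lt_succ_iff.2 hβ) x h3 h3'

theorem guessesAtRank_rankedLadder
    (hcof : ∀ α ∈ S, IsSuccLimit α → IsCofinalSubset (a α) α)
    (h : ∀ n, ∀ B₀ B₁, IsCofinalSubset B₀ κ.ord → IsCofinalSubset B₁ κ.ord →
      ∃ α ∈ S, r α = n ∧ α < κ.ord ∧ IsSuccLimit α ∧
        (∀ b < α, ∃ y ∈ B₀, y ∈ a α ∧ b ≤ y) ∧ ∀ b < α, ∃ y ∈ B₁, y ∈ a α ∧ b ≤ y) :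
    GuessesAtRank κ (rankedLadder S a r) r := by
  intro n B₀ B₁ hB₀ hB₁ hr₀ hr₁
  obtain ⟨α, hαS, rfl, hακ, hl, h₀, h₁⟩ := h n B₀ B₁ hB₀ hB₁
  -- The guessed points of `B₀` have rank below `r α`, so they witness that discarding the higher
  -- ranks leaves the ladder cofinal.
  have hgood : α ∈ S ∧ IsSuccLimit α ∧ IsCofinalSubset {β ∈ a α | r β < r α} α := by
    refine ⟨hαS, hl, fun β hβ => (hcof α hαS hl).1 hβ.1, fun b hb => ?_⟩
    obtain ⟨y, hy, hya, hby⟩ := h₀ b hb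
    exact ⟨y, ⟨hya, hr₀ y hy⟩, hby⟩
  refine ⟨α, hακ, hl.bot_lt, rfl, fun b hb => ?_, fun b hb => ?_⟩
  · obtain ⟨y, hy, hya, hby⟩ := h₀ b hb
    exact ⟨y, hy, mem_rankedLadder.2 ⟨hgood, hya, hr₀ y hy⟩, hby⟩
  · obtain ⟨y, hy, hya, hby⟩ := h₁ b hb
    exact ⟨y, hy, mem_rankedLadder.2 ⟨hgood, hya, hr₁ y hy⟩, hby⟩

end rankedLadder

end LadderDowker

theorem theoremB (κ : Cardinal.{u}) (hκ : κ.IsRegular) (hκ' : Cardinal.aleph0 < κ)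
    (S : Set Ordinal.{u}) (hS : LadderDowker.IsNonReflectingStationary κ S)
    (𝒮 : Set (Set Ordinal.{u})) (h𝒮 : LadderDowker.IsPartitionOf 𝒮 S) (h𝒮inf : 𝒮.Infinite)
    (hclub : LadderDowker.ClubAD κ 𝒮 1 2) :
    ∃ L : Ordinal.{u} → Set Ordinal.{u},
      LadderDowker.IsLadderSystem κ L ∧
      LadderDowker.IsDowkerSpace (LadderDowker.LadderSpace κ L) ∧
      Cardinal.mk (LadderDowker.LadderSpace κ L) = Cardinal.lift.{u + 1} κ := by
  obtain ⟨a, hcof, had, hguess⟩ := hclub.exists_ladder hκ hκ'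
  rw [h𝒮.sUnion_eq] at hcof had
  obtain ⟨r, hr⟩ := h𝒮.exists_rank h𝒮inf
  have hL := LadderDowker.isLadderSystem_rankedLadder (κ := κ) (S := S) (a := a) (r := r)
  refine ⟨LadderDowker.rankedLadder S a r, hL, hL.isDowkerSpace hκ hκ' (r := r)
    (fun α β hβ => (LadderDowker.mem_rankedLadder.1 hβ).2.2)
    (LadderDowker.guessesAtRank_rankedLadder hcof fun n B₀ B₁ hB₀ hB₁ => ?_)
    (LadderDowker.hasDisjointTails_rankedLadder hκ hS hcof had), ?_⟩
  · obtain ⟨T, hT, hTr⟩ := hr n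
    obtain ⟨α, hα, h⟩ := hguess B₀ B₁ hB₀ hB₁ T hT
    exact ⟨α, h𝒮.sUnion_eq ▸ ⟨T, hT, hα⟩, hTr α hα, h⟩
  · exact (Cardinal.mk_Iio_ordinal κ.ord).trans (by rw [Cardinal.card_ord])
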